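/- Conventions. An action of a monoid $S$ on an abelian group $A$ is a monoid homomorphism $\alpha\colon S\to\mathrm{End}(A)$. A right Følner net of $S$ is a net $(F_i)_{i\in I}$ of non-empty finite subsets of $S$ with $\lim_i |F_is\setminus F_i|/|F_i|=0$ for every $s\in S$. For non-empty finite sets $F\subseteq S$ and $X\subseteq A$ put $T_F(\alpha,X)=\sum_{s\in F}\alpha(s)(X)$ (Minkowski sum), let $H_{alg}(\alpha,X)=\lim_i \frac{\log|T_{F_i}(\alpha,X)|}{|F_i|}$, where $(F_i)$ is any right Følner net of $S$, and let $h_{alg}(\alpha)=\sup_X H_{alg}(\alpha,X)$ over all non-empty finite $X\subseteq A$ be the algebraic entropy of $\alpha$. For an abelian group $A$ let $r_0(A)=\dim_{\mathbb Q}(\mathbb Q\otimes A)$ be its (free) rank and, for a prime $p$, let $r_p(A)=\dim_{\mathbb Z/p\mathbb Z}A[p]$, where $A[p]=\{x\in A: px=0\}$; $A$ has finite ranks if $r_0(A)<\infty$ and $r_p(A)<\infty$ for every prime $p$. A group is non-torsion if it has an element of infinite order, and virtually cyclic if it has a cyclic subgroup of finite index. Theorem. Let $A$ be an abelian group. (1)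 If $A$ is torsion-free of finite rank and $d>1$, then every action $\alpha$ of $\mathbb N^d$ on $A$ satisfies $h_{alg}(\alpha)=0$. (2) If $A$ is torsion-free of finite rank and $d>1$, then every action $\alpha$ of $\mathbb Z^d$ on $A$ satisfies $h_{alg}(\alpha)=0$. (3) If $A$ has finite ranks and $G$ is an abelian group that is non-torsion and not virtually cyclic, then every action $\alpha$ of $G$ on $A$ satisfies $h_{alg}(\alpha)=0$. In each case it is part of the assertion that the entropy is well defined: the acting monoid has a right Følner net and, for every non-empty finite $X\subseteq A$, the limit defining $H_{alg}(\alpha,X)$ exists along every right Følner net and does not depend on it. -/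

import Mathlib

open Filter Topology TensorProduct
open scoped Pointwise

universe u v

namespace AlgebraicEntropy

/-- A right Følner net of a monoid `S`: a net `(F i)` (indexed by a non-empty directed set `ι`)
of non-empty finite subsets of `S` such that, for every `s : S`,
`|F i s \ F i| / |F i|` tends to `0`. -/
structure IsRightFolnerNet {S : Type u} [Monoid S] {ι : Type v} [Preorder ι]
    (F : ι → Finset S) : Prop where
  nonempty_index : Nonempty ι
  directed : IsDirectedOrder ι
  nonempty : ∀ i, (F i).Nonempty
  tendsto : ∀ s : S, Tendsto
    (fun i => (Set.ncard (((fun x => x * s) '' (F i : Set S)) \ (F i : Set S)) : ℝ) /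
      ((F i).card : ℝ)) atTop (𝓝 0)

open Classical in
/-- The trajectory `T_F(α, X) = ∑_{s ∈ F} α(s)(X)` (a Minkowski sum) of a finite set `X ⊆ A`
under a left action `α` of `S` on `A` by group endomorphisms. -/
noncomputable def trajectory {S : Type u} [Monoid S] {A : Type v} [AddCommGroup A]
    (α : S →* AddMonoid.End A) (F : Finset S) (X : Finset A) : Finset A :=
  ∑ s ∈ F, X.image (α s)

/-- `S` has a right Følner net, and `c` is the limit of `log |T_{F i}(α, X)| / |F i|` along every
right Følner net `(F i)` of `S`. -/
def IsEntropyAt {S : Type u} [Monoid S] {A : Type v} [AddCommGroup A]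
    (α : S →* AddMonoid.End A) (X : Finset A) (c : ℝ) : Prop :=
  (∃ (ι : Type u) (_ : Preorder ι) (F : ι → Finset S), IsRightFolnerNet F) ∧
  ∀ (ι : Type u) [Preorder ι] (F : ι → Finset S), IsRightFolnerNet F →
    Tendsto (fun i => Real.log ((trajectory α (F i) X).card : ℝ) / ((F i).card : ℝ))
      atTop (𝓝 c)

open Classical in
/-- The algebraic entropy `H_alg(α, X)` of `α` with respect to `X`: the common limit of
`log |T_{F i}(α, X)| / |F i|` along the right Følner nets of `S`
(with value `0` if there is no such common limit; see `EntropyWellDefined`). -/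
noncomputable def HAlg {S : Type u} [Monoid S] {A : Type v} [AddCommGroup A]
    (α : S →* AddMonoid.End A) (X : Finset A) : ℝ :=
  if h : ∃ c : ℝ, IsEntropyAt α X c then h.choose else 0

/-- For every non-empty finite `X ⊆ A` the limit defining `H_alg(α, X)` exists and does not depend
on the right Følner net (and there is such a net). -/
def EntropyWellDefined {S : Type u} [Monoid S] {A : Type v} [AddCommGroup A]
    (α : S →* AddMonoid.End A) : Prop :=
  ∀ X : Finset A, X.Nonempty → IsEntropyAt α X (HAlg α X)

/-- The algebraic entropy `h_alg(α)`: the supremum of `H_alg(α, X)` over the non-empty finite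
subsets `X` of `A`. -/
noncomputable def hAlg {S : Type u} [Monoid S] {A : Type v} [AddCommGroup A]
    (α : S →* AddMonoid.End A) : EReal :=
  ⨆ X : {X : Finset A // X.Nonempty}, (HAlg α X.1 : EReal)

/-- The free rank `r₀(A) = dim_ℚ (ℚ ⊗ A)` of an abelian group. -/
noncomputable def freeRank (A : Type u) [AddCommGroup A] : Cardinal :=
  Module.rank ℚ (ℚ ⊗[ℤ] A)

/-- The `p`-rank `r_p(A) = dim_{ℤ/p} A[p]` of an abelian group, where `A[p] = {x | p x = 0}`. -/
noncomputable def pRank (p : ℕ) (A : Type u) [AddCommGroup A] : Cardinal :=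
  letI : Module (ZMod p) (AddSubgroup.torsionBy A (p : ℤ)) := AddSubgroup.torsionBy.zmodModule
  Module.rank (ZMod p) (AddSubgroup.torsionBy A (p : ℤ))

/-- Abelian groups with finite ranks: `r₀(A)` and all `r_p(A)`, `p` prime, are finite. -/
def HasFiniteRanks (A : Type u) [AddCommGroup A] : Prop :=
  freeRank A < Cardinal.aleph0 ∧ ∀ p : ℕ, p.Prime → pRank p A < Cardinal.aleph0

/-- A group is virtually cyclic if it has a cyclic subgroup of finite index. -/
def IsVirtuallyCyclic (G : Type u) [Group G] : Prop :=
  ∃ H : Subgroup G, IsCyclic H ∧ H.FiniteIndex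

end AlgebraicEntropy

/-! Zero entropy comes from a single element `g` of the acting monoid `S`. Two properties are
needed. First, the partial trajectories of `α g` have at most `C * B ^ n` elements, with `B`
independent of the starting set (`HasBoundedGrowth`). Second, `S` contains strips `{g ^ i * p | i <
N, p ∈ P}` of arbitrary width `|P|` (`IsThickAlong`).

A maximal packing of strips `E` covers a Følner set `F` by at most `|F * E| / |E| ≤ 2|F| / (N|P|)`
translates of a strip `E'` of length `2N` and width `P'`. Each translate contributes at most `log C
+ 2N log B` to `log |T_F|`. Hence `log |T_F| / |F|` is at most about `2 log C / (N|P|) + 4 log B /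
|P|`, which is small once `|P|` and then `N` are large. The limit is thus 0 along every net, and no
general convergence theorem is needed.

Bounded growth over `ℚ ^ r` is a count of numerators and denominators. For finite ranks it lifts
along `A → ℚ ⊗ A`: the `ℤ[X]`-module generated by a finite set is noetherian, so its torsion lies in
a finite `A[m]`, which affects only `C`. -/

namespace AlgebraicEntropy

/-! ### Trajectories under unions and translates. -/

section Trajectory

variable {S : Type u} [CommMonoid S] {A : Type v} [AddCommGroup A]

theorem trajectory_nonempty (α : S →* AddMonoid.End A) (F : Finset S) {X : Finset A}
    (hX : X.Nonempty) : (trajectory α F X).Nonempty := by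
  classical
  unfold trajectory
  induction F using Finset.induction_on with
  | empty => simp
  | insert a F ha ih =>
    rw [Finset.sum_insert ha]
    exact (hX.image _).add ih

theorem zero_mem_trajectory (α : S →* AddMonoid.End A) (F : Finset S) {X : Finset A}
    (hX : 0 ∈ X) : 0 ∈ trajectory α F X := by
  classical
  unfold trajectory
  induction F using Finset.induction_on with
  | empty => simp
  | insert a F ha ih =>
    rw [Finset.sum_insert ha]
    exact Finset.mem_add.2 ⟨0, Finset.mem_image.2 ⟨0, hX, map_zero _⟩, 0, ih, add_zero 0⟩

theorem trajectory_mono_right (α : S →* AddMonoid.End A) (F : Finset S) {X Y : Finset A}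
    (h : X ⊆ Y) : trajectory α F X ⊆ trajectory α F Y := by
  classical
  unfold trajectory
  induction F using Finset.induction_on with
  | empty => simp
  | insert a F ha ih =>
    rw [Finset.sum_insert ha, Finset.sum_insert ha]
    exact Finset.add_subset_add (Finset.image_subset_image h) ih

/-- Because `0 ∈ X`, the extra summands indexed by `F' \ F` can all be taken to be 0. -/
theorem trajectory_mono_left (α : S →* AddMonoid.End A) {F F' : Finset S} (h : F ⊆ F')
    {X : Finset A} (hX : 0 ∈ X) : trajectory α F X ⊆ trajectory α F' X := by
  classical
  have h0 := zero_mem_trajectory α (F' \ F) hX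
  unfold trajectory at *
  rw [← Finset.sum_sdiff h]
  exact Finset.subset_add_right _ h0

open Classical in
theorem trajectory_union_subset (α : S →* AddMonoid.End A) (F F' : Finset S)
    {X : Finset A} (hX : 0 ∈ X) :
    trajectory α (F ∪ F') X ⊆ trajectory α F X + trajectory α F' X := by
  have h : trajectory α (F ∪ F') X = trajectory α F X + trajectory α (F' \ F) X := by
    unfold trajectory
    rw [← Finset.union_sdiff_self_eq_union, Finset.sum_union Finset.disjoint_sdiff]
  rw [h]
  exact Finset.add_subset_add_left (trajectory_mono_left α Finset.sdiff_subset hX)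

open Classical in
theorem trajectory_biUnion_subset (α : S →* AddMonoid.End A) {ι : Type*} (I : Finset ι)
    (F : ι → Finset S) {X : Finset A} (hX : 0 ∈ X) :
    trajectory α (I.biUnion F) X ⊆ ∑ i ∈ I, trajectory α (F i) X := by
  induction I using Finset.induction_on with
  | empty => simp [trajectory]
  | insert a I ha ih =>
    rw [Finset.sum_insert ha, Finset.biUnion_insert]
    exact (trajectory_union_subset α _ _ hX).trans (Finset.add_subset_add_left ih)

theorem image_finset_sum {B : Type*} [AddCommGroup B] [DecidableEq A] [DecidableEq B]
    (f : A →+ B) {ι : Type*} (I : Finset ι) (F : ι → Finset A) :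
    (∑ i ∈ I, F i).image f = ∑ i ∈ I, (F i).image f :=
  map_sum (Finset.imageAddMonoidHom f) F I

-- Cancellation keeps the translated indices distinct, so `α x` factors out of the sum. Translating
-- therefore never enlarges a trajectory.
open Classical in
theorem trajectory_translate [IsCancelMul S] (α : S →* AddMonoid.End A) (x : S) (F : Finset S)
    (X : Finset A) :
    trajectory α (F.image (x * ·)) X = (trajectory α F X).image (α x) := by
  unfold trajectory
  rw [Finset.sum_image (fun a _ b _ h => mul_left_cancel h)]
  have := image_finset_sum (α x : A →+ A) F (fun s => X.image (α s))
  refine Eq.trans ?_ this.symm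
  refine Finset.sum_congr rfl fun s _ => ?_
  rw [Finset.image_image, map_mul]
  rfl

theorem card_finset_sum_le [DecidableEq A] {ι : Type*} (I : Finset ι) (F : ι → Finset A) {n : ℕ}
    (h : ∀ i ∈ I, (F i).card ≤ n) : (∑ i ∈ I, F i).card ≤ n ^ I.card := by
  classical
  induction I using Finset.induction_on with
  | empty => simp
  | insert a I ha ih =>
    rw [Finset.sum_insert ha, Finset.card_insert_of_notMem ha, pow_succ']
    exact Finset.card_add_le.trans (Nat.mul_le_mul (h a (Finset.mem_insert_self _ _))
      (ih fun i hi => h i (Finset.mem_insert_of_mem hi)))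

open Classical in
/-- If `F` is covered by translates of `E` then `|T_F| ≤ |T_E| ^ r` with `r` the number of
translates. -/
theorem card_trajectory_le_of_cover [IsCancelMul S] (α : S →* AddMonoid.End A) {F E : Finset S}
    {ι : Type*} (I : Finset ι) (y : ι → S)
    (hF : F ⊆ I.biUnion fun i => E.image (y i * ·)) {X : Finset A} (hX : 0 ∈ X) :
    (trajectory α F X).card ≤ (trajectory α E X).card ^ I.card := by
  refine (Finset.card_le_card ((trajectory_mono_left α hF hX).trans
    (trajectory_biUnion_subset α I _ hX))).trans (card_finset_sum_le I _ fun i _ => ?_)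
  rw [trajectory_translate]
  exact Finset.card_image_le

end Trajectory

open Classical in
/-- The `n`-th partial trajectory `Y + φ(Y) + ⋯ + φ ^ (n - 1) (Y)` of an endomorphism. -/
noncomputable def orbitSum {A : Type v} [AddCommGroup A] (φ : AddMonoid.End A) (n : ℕ)
    (Y : Finset A) : Finset A :=
  ∑ i ∈ Finset.range n, Y.image (φ ^ i : AddMonoid.End A)

/-- The partial trajectories of `φ` grow exponentially with a rate that does not depend on
the starting set. -/
def HasBoundedGrowth {A : Type v} [AddCommGroup A] (φ : AddMonoid.End A) : Prop :=
  ∃ B : ℕ, ∀ Y : Finset A, ∃ C : ℕ, ∀ n : ℕ, (orbitSum φ n Y).card ≤ C * B ^ n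

-- Horner form of the partial trajectory, the recursion behind every induction on `n` below.
open Classical in
theorem orbitSum_succ_classical {A : Type v} [AddCommGroup A] (φ : AddMonoid.End A) (n : ℕ)
    (Y : Finset A) : orbitSum φ (n + 1) Y = Y + (orbitSum φ n Y).image φ := by
  unfold orbitSum
  rw [Finset.sum_range_succ', add_comm]
  congr 1
  · ext; simp
  · have := image_finset_sum (φ : A →+ A) (Finset.range n)
      (fun i => Y.image (φ ^ i : AddMonoid.End A))
    refine Eq.trans ?_ this.symm
    refine Finset.sum_congr rfl fun s _ => ?_
    rw [Finset.image_image, pow_succ']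
    rfl

theorem orbitSum_succ {A : Type v} [AddCommGroup A] [d : DecidableEq A] (φ : AddMonoid.End A)
    (n : ℕ) (Y : Finset A) : orbitSum φ (n + 1) Y = Y + (orbitSum φ n Y).image φ := by
  obtain rfl : d = fun a b => Classical.propDecidable (a = b) := Subsingleton.elim _ _
  exact orbitSum_succ_classical φ n Y

-- Passage from the monoid to one endomorphism: the row `g ^ i * P` contributes `α(g) ^ i` applied
-- to the trajectory of `P`.
open Classical in
theorem trajectory_strip_subset {S : Type u} [CommMonoid S] [IsCancelMul S] {A : Type v}
    [AddCommGroup A] (α : S →* AddMonoid.End A) (g : S) (n : ℕ) (P : Finset S) {X : Finset A}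
    (hX : 0 ∈ X) :
    trajectory α ((Finset.range n).biUnion fun i => P.image (g ^ i * ·)) X ⊆
      orbitSum (α g) n (trajectory α P X) := by
  refine (trajectory_biUnion_subset α _ _ hX).trans (Finset.subset_of_eq ?_)
  refine Finset.sum_congr rfl fun i _ => ?_
  rw [trajectory_translate, map_pow]

/-! ### Følner sets in commutative monoids. -/

section Folner

/-- Every commutative monoid satisfies the Følner condition. -/
theorem exists_folner_set {S : Type u} [CommMonoid S] (K : Finset S) {ε : ℝ} (hε : 0 < ε) :
    ∃ F : Finset S, F.Nonempty ∧ ∀ s ∈ K,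
      (Set.ncard (((fun x => x * s) '' (F : Set S)) \ (F : Set S)) : ℝ) ≤ ε * F.card := by
  classical
  let F : ℕ → Finset S := fun M =>
    (Fintype.piFinset fun _ : K => Finset.range (M + 1)).image fun a : K → ℕ => ∏ s : K, (s : S) ^ a s
  have hne : ∀ M, (F M).Nonempty := fun M => by
    refine Finset.Nonempty.image ⟨fun _ => 0, by simp⟩ _
  have hcard : ∀ M, (F M).card ≤ (M + 1) ^ K.card := fun M => by
    refine Finset.card_image_le.trans ?_
    simp
  have hmono : ∀ M, F M ⊆ F (M + 1) := fun M => by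
    refine Finset.image_subset_image fun a ha => ?_
    simp only [Fintype.mem_piFinset, Finset.mem_range] at ha ⊢
    intro s
    have := ha s
    omega
  have hmul : ∀ M, ∀ s ∈ K, ∀ x ∈ F M, x * s ∈ F (M + 1) := fun M s hs x hx => by
    obtain ⟨a, ha, rfl⟩ := Finset.mem_image.1 hx
    refine Finset.mem_image.2 ⟨a + Pi.single ⟨s, hs⟩ 1, ?_, ?_⟩
    · simp only [Fintype.mem_piFinset, Finset.mem_range] at ha ⊢
      intro t
      have h1 := ha t
      have h2 : (Pi.single ⟨s, hs⟩ 1 : K → ℕ) t ≤ 1 := by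
        rw [Pi.single_apply]; split_ifs <;> simp
      simp only [Pi.add_apply]
      omega
    · simp only [Pi.add_apply, pow_add, Finset.prod_mul_distrib]
      congr 1
      rw [Finset.prod_eq_single ⟨s, hs⟩]
      · simp
      · intro b _ hb
        simp [hb]
      · simp
  -- Commutativity bounds `|F M|` polynomially in `M`, so it cannot grow by a factor `1 + ε` at
  -- every step.
  obtain ⟨M, hM⟩ : ∃ M, ((F (M + 1)).card : ℝ) ≤ (1 + ε) * (F M).card := by
    by_contra! hcon
    have hgrow : ∀ M, (1 + ε) ^ M ≤ ((F M).card : ℝ) := by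
      intro M
      induction M with
      | zero => simpa using hne 0
      | succ M ih =>
        rw [pow_succ']
        exact (mul_le_mul_of_nonneg_left ih (by positivity)).trans (hcon M).le
    have hlim := tendsto_pow_const_div_const_pow_of_one_lt K.card (r := 1 + ε) (by linarith)
    have hlim1 := (tendsto_add_atTop_iff_nat 1).2 hlim
    have hlt := hlim1.eventually_lt_const (u := (1 + ε)⁻¹) (by positivity)
    obtain ⟨M, hM⟩ := hlt.exists
    have h1 := (hgrow M).trans (Nat.cast_le.2 (hcard M))
    push_cast at h1 hM
    rw [div_lt_iff₀ (by positivity), pow_succ', inv_mul_cancel_left₀ (by positivity)] at hM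
    linarith
  refine ⟨F M, hne M, fun s hs => ?_⟩
  have hsub : ((fun x => x * s) '' (F M : Set S)) \ (F M : Set S) ⊆
      ((F (M + 1) \ F M : Finset S) : Set S) := by
    rintro _ ⟨⟨x, hx, rfl⟩, hx'⟩
    rw [Finset.coe_sdiff]
    exact ⟨hmul M s hs x hx, hx'⟩
  have h1 := Set.ncard_le_ncard hsub (Finset.finite_toSet _)
  rw [Set.ncard_coe_finset] at h1
  have h2 := Finset.card_sdiff_add_card_eq_card (hmono M)
  have h3 : ((F (M + 1) \ F M).card : ℝ) + (F M).card = (F (M + 1)).card := by exact_mod_cast h2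
  have h4 : (Set.ncard (((fun x => x * s) '' (F M : Set S)) \ (F M : Set S)) : ℝ) ≤
    (F (M + 1) \ F M).card := by exact_mod_cast h1
  linarith

theorem exists_rightFolnerNet (S : Type u) [CommMonoid S] :
    ∃ (ι : Type u) (_ : Preorder ι) (F : ι → Finset S), IsRightFolnerNet F := by
  classical
  choose F hne hF using fun i : Finset S × ℕ =>
    exists_folner_set i.1 (ε := 1 / ((i.2 : ℝ) + 1)) (by positivity)
  refine ⟨Finset S × ℕ, inferInstance, F, ⟨inferInstance, inferInstance, hne, fun s => ?_⟩⟩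
  have hlim : Tendsto (fun i : Finset S × ℕ => 1 / ((i.2 : ℝ) + 1)) atTop (𝓝 0) := by
    refine (tendsto_one_div_add_atTop_nhds_zero_nat (𝕜 := ℝ)).comp ?_
    rw [← prod_atTop_atTop_eq]
    exact tendsto_snd
  refine squeeze_zero' (Eventually.of_forall fun i => by positivity) ?_ hlim
  filter_upwards [eventually_ge_atTop (({s}, 0) : Finset S × ℕ)] with i hi
  rw [div_le_iff₀ (by exact_mod_cast (hne i).card_pos)]
  exact hF i s (hi.1 (Finset.mem_singleton_self s))

open Classical in
theorem IsRightFolnerNet.eventually_card_mul_le {S : Type u} [CommMonoid S] {ι : Type v}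
    [Preorder ι] {F : ι → Finset S} (hF : IsRightFolnerNet F) (E : Finset S) :
    ∀ᶠ i in atTop, (F i * E).card ≤ 2 * (F i).card := by
  have hlim := tendsto_finsetSum E fun s _ => hF.tendsto s
  rw [Finset.sum_const_zero] at hlim
  filter_upwards [hlim.eventually_le_const zero_lt_one] with i hi
  have hpos : (0 : ℝ) < (F i).card := by exact_mod_cast (hF.nonempty i).card_pos
  rw [← Finset.sum_div, div_le_one hpos] at hi
  have hsub : F i * E ⊆ F i ∪ E.biUnion fun s => (F i).image (fun x => x * s) \ F i := by
    intro z hz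
    obtain ⟨x, hx, s, hs, rfl⟩ := Finset.mem_mul.1 hz
    by_cases h : x * s ∈ F i
    · exact Finset.mem_union_left _ h
    · refine Finset.mem_union_right _ (Finset.mem_biUnion.2 ⟨s, hs, ?_⟩)
      exact Finset.mem_sdiff.2 ⟨Finset.mem_image_of_mem (fun x => x * s) hx, h⟩
  have hcard := (Finset.card_le_card hsub).trans ((Finset.card_union_le _ _).trans
    (Nat.add_le_add_left Finset.card_biUnion_le _))
  have heq : ∀ s, Set.ncard (((fun x => x * s) '' (F i : Set S)) \ (F i : Set S)) =
      ((F i).image (fun x => x * s) \ F i).card := fun s => by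
    rw [← Set.ncard_coe_finset, Finset.coe_sdiff, Finset.coe_image]
  simp only [heq] at hi
  have hi' : ∑ s ∈ E, ((F i).image (fun x => x * s) \ F i).card ≤ (F i).card := by
    exact_mod_cast hi
  omega

end Folner

/-! ### The vanishing criterion: packing by strips. -/

section Criterion

open Classical in
/-- Covering of a finite set by few translates, from a maximal packing. -/
theorem exists_cover {S : Type u} [CommMonoid S] [IsCancelMul S] (F E E' : Finset S)
    (hE : E.Nonempty)
    (h : ∀ x : S, ∃ y : S, ∀ z : S, (∃ e ∈ E, ∃ e' ∈ E, z * e = x * e') → ∃ q ∈ E', z = y * q) :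
    ∃ (I : Finset S) (y : S → S), F ⊆ (I.biUnion fun x => E'.image (y x * ·)) ∧
      I.card * E.card ≤ (F * E).card := by
  choose y hy using h
  -- Packings: sets of centres in `F` whose translates of `E` are disjoint. By maximality every `z ∈
  -- F` has `z * E` meeting some `x * E`, which the hypothesis turns into membership in `y x * E'`.
  let Q : Finset (Finset S) := F.powerset.filter fun I =>
    (I : Set S).PairwiseDisjoint fun x => E.image (x * ·)
  obtain ⟨I, hI⟩ : ∃ I, Maximal (· ∈ Q) I :=
    Finset.exists_maximal ⟨∅, by simp [Q]⟩
  have hIQ := Finset.mem_filter.1 hI.1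
  have hIF := Finset.mem_powerset.1 hIQ.1
  refine ⟨I, y, fun z hz => ?_, ?_⟩
  · rw [Finset.mem_biUnion]
    suffices ∃ x ∈ I, ∃ e ∈ E, ∃ e' ∈ E, z * e = x * e' by
      obtain ⟨x, hx, hxe⟩ := this
      obtain ⟨q, hq, rfl⟩ := hy x z hxe
      exact ⟨x, hx, Finset.mem_image_of_mem (y x * ·) hq⟩
    by_cases hzI : z ∈ I
    · obtain ⟨e, he⟩ := hE
      exact ⟨z, hzI, e, he, e, he, rfl⟩
    by_contra hcon
    push Not at hcon
    have hins : insert z I ∈ Q := by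
      refine Finset.mem_filter.2 ⟨Finset.mem_powerset.2 (Finset.insert_subset hz hIF), ?_⟩
      rw [Finset.coe_insert]
      refine hIQ.2.insert fun x hx _ => ?_
      refine Finset.disjoint_left.2 fun w hw hw' => ?_
      obtain ⟨e, he, rfl⟩ := Finset.mem_image.1 hw
      obtain ⟨e', he', h⟩ := Finset.mem_image.1 hw'
      exact hcon x hx e he e' he' h.symm
    exact hzI (hI.2 hins (Finset.subset_insert z I) (Finset.mem_insert_self z I))
  · have hcard := Finset.card_biUnion hIQ.2
    rw [Finset.sum_congr rfl fun x _ =>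
      Finset.card_image_of_injective E (mul_right_injective x), Finset.sum_const,
      smul_eq_mul] at hcard
    rw [← hcard]
    refine Finset.card_le_card (Finset.biUnion_subset.2 fun x hx => ?_)
    intro w hw
    obtain ⟨e, he, rfl⟩ := Finset.mem_image.1 hw
    exact Finset.mul_mem_mul (hIF hx) he

/-- `S` is thick transversally to `g`: it contains arbitrarily large finite sets `P` such that
the strips `{g ^ i * p | i < n, p ∈ P}` are non-degenerate and any strip meeting a given
translate of itself lies in a controlled strip of twice the length. -/
def IsThickAlong {S : Type u} [CommMonoid S] (g : S) : Prop :=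
  ∀ K : ℕ, ∃ P P' : Finset S, K ≤ P.card ∧
    (∀ i j : ℕ, ∀ p ∈ P, ∀ q ∈ P, g ^ i * p = g ^ j * q → i = j ∧ p = q) ∧
    ∀ (n : ℕ) (x : S), ∃ y : S, ∀ z : S,
      (∃ i < n, ∃ p ∈ P, ∃ j < n, ∃ q ∈ P, z * (g ^ i * p) = x * (g ^ j * q)) →
        ∃ k < 2 * n, ∃ q ∈ P', z = y * (g ^ k * q)

theorem tendsto_entropy_zero_of_zero_mem {S : Type u} [CommMonoid S] [IsCancelMul S]
    {A : Type v} [AddCommGroup A] (α : S →* AddMonoid.End A) {g : S} (hg : IsThickAlong g)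
    (hα : HasBoundedGrowth (α g)) {X : Finset A} (hX : 0 ∈ X) {ι : Type u} [Preorder ι]
    {F : ι → Finset S} (hF : IsRightFolnerNet F) :
    Tendsto (fun i => Real.log ((trajectory α (F i) X).card : ℝ) / ((F i).card : ℝ))
      atTop (𝓝 0) := by
  classical
  have hpos : ∀ G : Finset S, 1 ≤ (trajectory α G X).card := fun G =>
    (trajectory_nonempty α G ⟨0, hX⟩).card_pos
  have hnonneg : ∀ G : Finset S, 0 ≤ Real.log ((trajectory α G X).card : ℝ) := fun G =>
    Real.log_natCast_nonneg _
  obtain ⟨B, hB⟩ := hα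
  refine tendsto_order.2 ⟨fun a ha => Eventually.of_forall fun i =>
    ha.trans_le (div_nonneg (hnonneg _) (Nat.cast_nonneg _)), fun ε hε => ?_⟩
  -- The order of choices matters: the width beats `log B`, which does not depend on `P'`; the
  -- constant `C` does depend on `P'`, and the length, chosen last, beats `log C`.
  obtain ⟨K, hK⟩ := exists_nat_gt (8 * Real.log B / ε)
  obtain ⟨P, P', hPK, hinj, hcov⟩ := hg (K + 1)
  obtain ⟨C, hC⟩ := hB (trajectory α P' X)
  obtain ⟨n, hn⟩ := exists_nat_gt (4 * Real.log C / ε)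
  let N := n + 1
  let E : Finset S := (Finset.range N).biUnion fun i => P.image (g ^ i * ·)
  let E' : Finset S := (Finset.range (2 * N)).biUnion fun i => P'.image (g ^ i * ·)
  have hEcard : E.card = N * P.card := by
    rw [Finset.card_biUnion]
    · rw [Finset.sum_congr rfl fun x _ =>
        Finset.card_image_of_injective P (mul_right_injective (g ^ x)), Finset.sum_const,
        smul_eq_mul, Finset.card_range]
    · intro i _ j _ hij
      refine Finset.disjoint_left.2 fun w hw hw' => hij ?_
      obtain ⟨p, hp, rfl⟩ := Finset.mem_image.1 hw
      obtain ⟨q, hq, h⟩ := Finset.mem_image.1 hw'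
      exact (hinj i j p hp q hq h.symm).1
  have hEpos : 0 < E.card := by rw [hEcard]; exact Nat.mul_pos (Nat.succ_pos n) (by omega)
  have hE' : Real.log ((trajectory α E' X).card : ℝ) ≤ Real.log C + 2 * N * Real.log B := by
    have h1 : (trajectory α E' X).card ≤ C * B ^ (2 * N) :=
      (Finset.card_le_card (trajectory_strip_subset α g _ P' hX)).trans (hC _)
    have h2 : 0 < C * B ^ (2 * N) := lt_of_lt_of_le (hpos E') h1
    have hC0 : (C : ℝ) ≠ 0 := by
      rintro h
      rw [Nat.cast_eq_zero.1 h] at h2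
      simp at h2
    have hB0 : (B : ℝ) ^ (2 * N) ≠ 0 := by
      intro h
      have : B ^ (2 * N) = 0 := by exact_mod_cast h
      simp [this] at h2
    have h3 : ((trajectory α E' X).card : ℝ) ≤ C * B ^ (2 * N) := by exact_mod_cast h1
    have h4 := Real.log_le_log (by exact_mod_cast hpos E') h3
    rw [Real.log_mul hC0 hB0, Real.log_pow] at h4
    push_cast at h4
    exact h4
  -- The factor 2 pays for `|F * E| ≤ 2|F|` in the count of translates.
  have hmain : 2 * Real.log ((trajectory α E' X).card : ℝ) < ε * E.card := by
    have hlogB : 0 ≤ Real.log B := Real.log_natCast_nonneg B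
    rw [div_lt_iff₀ hε] at hK hn
    have hN : (1 : ℝ) ≤ N := by simp [N]
    have hnN : (n : ℝ) ≤ N := by simp [N]
    have hPK' : (K : ℝ) + 1 ≤ P.card := by exact_mod_cast hPK
    rw [hEcard]
    push_cast
    have a1 : 4 * Real.log C < N * ε := hn.trans_le (by gcongr)
    have a2 : (N : ℝ) * (8 * Real.log B) ≤ N * (K * ε) := by gcongr
    have a3 : (N : ℝ) * ε * (K + 1) ≤ N * ε * P.card := by gcongr
    nlinarith [mul_nonneg (by linarith : (0 : ℝ) ≤ N) (mul_nonneg (Nat.cast_nonneg (α := ℝ) K) hε.le)]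
  filter_upwards [hF.eventually_card_mul_le E] with i hi
  have hFpos : (0 : ℝ) < (F i).card := by exact_mod_cast (hF.nonempty i).card_pos
  rw [div_lt_iff₀ hFpos]
  obtain ⟨I, y, hcover, hI⟩ := exists_cover (F i) E E' (Finset.card_pos.1 hEpos) (by
    intro x
    obtain ⟨y, hy⟩ := hcov N x
    refine ⟨y, fun z ⟨e, he, e', he', h⟩ => ?_⟩
    obtain ⟨i, hi, hei⟩ := Finset.mem_biUnion.1 he
    obtain ⟨p, hp, rfl⟩ := Finset.mem_image.1 hei
    obtain ⟨j, hj, hej⟩ := Finset.mem_biUnion.1 he'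
    obtain ⟨q, hq, rfl⟩ := Finset.mem_image.1 hej
    obtain ⟨k, hk, r, hr, rfl⟩ := hy z ⟨i, Finset.mem_range.1 hi, p, hp, j,
      Finset.mem_range.1 hj, q, hq, h⟩
    exact ⟨g ^ k * r, Finset.mem_biUnion.2 ⟨k, Finset.mem_range.2 hk,
      Finset.mem_image_of_mem (g ^ k * ·) hr⟩, rfl⟩)
  have hT := card_trajectory_le_of_cover α I y hcover hX
  have hT' : Real.log ((trajectory α (F i) X).card : ℝ) ≤
      I.card * Real.log ((trajectory α E' X).card : ℝ) := by
    rw [← Real.log_pow]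
    exact Real.log_le_log (by exact_mod_cast hpos _) (by exact_mod_cast hT)
  have hI' : (I.card : ℝ) * E.card ≤ 2 * (F i).card := by exact_mod_cast hI.trans hi
  have hEpos' : (0 : ℝ) < E.card := by exact_mod_cast hEpos
  have key : Real.log ((trajectory α (F i) X).card : ℝ) * (2 * E.card) <
      ε * (F i).card * (2 * E.card) := by
    have b1 : Real.log ((trajectory α (F i) X).card : ℝ) * (2 * E.card) ≤
        (I.card * E.card) * (2 * Real.log ((trajectory α E' X).card : ℝ)) := by
      nlinarith
    have b2 : (I.card * E.card : ℝ) * (2 * Real.log ((trajectory α E' X).card : ℝ)) ≤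
        2 * (F i).card * (2 * Real.log ((trajectory α E' X).card : ℝ)) :=
      mul_le_mul_of_nonneg_right hI' (by have := hnonneg E'; linarith)
    have b3 : 2 * (F i).card * (2 * Real.log ((trajectory α E' X).card : ℝ)) <
        2 * (F i).card * (ε * E.card) :=
      mul_lt_mul_of_pos_left hmain (by linarith)
    calc _ ≤ _ := b1
      _ ≤ _ := b2
      _ < _ := b3
      _ = _ := by ring
  exact lt_of_mul_lt_mul_right key (by linarith)

/-- Adjoining 0 to `X` only enlarges trajectories, so the previous case gives an upper bound. -/
theorem tendsto_entropy_zero {S : Type u} [CommMonoid S] [IsCancelMul S]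
    {A : Type v} [AddCommGroup A] (α : S →* AddMonoid.End A) {g : S} (hg : IsThickAlong g)
    (hα : HasBoundedGrowth (α g)) {X : Finset A} (hX : X.Nonempty) {ι : Type u} [Preorder ι]
    {F : ι → Finset S} (hF : IsRightFolnerNet F) :
    Tendsto (fun i => Real.log ((trajectory α (F i) X).card : ℝ) / ((F i).card : ℝ))
      atTop (𝓝 0) := by
  classical
  refine squeeze_zero (fun i => div_nonneg (Real.log_natCast_nonneg _) (Nat.cast_nonneg _))
    (fun i => ?_) (tendsto_entropy_zero_of_zero_mem α hg hα (Finset.mem_insert_self 0 X) hF)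
  refine div_le_div_of_nonneg_right (Real.log_le_log ?_ ?_) (Nat.cast_nonneg _)
  · exact_mod_cast (trajectory_nonempty α (F i) hX).card_pos
  · exact_mod_cast Finset.card_le_card
      (trajectory_mono_right α (F i) (Finset.subset_insert 0 X))

theorem entropy_eq_zero {S : Type u} [CommMonoid S] [IsCancelMul S]
    {A : Type v} [AddCommGroup A] (α : S →* AddMonoid.End A) {g : S} (hg : IsThickAlong g)
    (hα : HasBoundedGrowth (α g)) : EntropyWellDefined α ∧ hAlg α = 0 := by
  have hzero : ∀ X : Finset A, X.Nonempty → IsEntropyAt α X 0 := fun X hX =>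
    ⟨exists_rightFolnerNet S, fun ι _ F hF => tendsto_entropy_zero α hg hα hX hF⟩
  have hH : ∀ X : Finset A, X.Nonempty → HAlg α X = 0 := fun X hX => by
    have hex : ∃ c, IsEntropyAt α X c := ⟨0, hzero X hX⟩
    have hc : HAlg α X = hex.choose := dif_pos hex
    rw [hc]
    -- The chosen value is pinned down by uniqueness of limits along one actual net.
    obtain ⟨ι, _, F, hF⟩ := exists_rightFolnerNet S
    have := hF.nonempty_index
    have := hF.directed
    exact tendsto_nhds_unique (hex.choose_spec.2 ι F hF) ((hzero X hX).2 ι F hF)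
  refine ⟨fun X hX => by rw [hH X hX]; exact hzero X hX, ?_⟩
  have : Nonempty {X : Finset A // X.Nonempty} := ⟨⟨{0}, Finset.singleton_nonempty 0⟩⟩
  unfold hAlg
  simp only [fun X : {X : Finset A // X.Nonempty} => hH X.1 X.2, EReal.coe_zero, ciSup_const]

end Criterion

/-! ### Finiteness and boundedness of torsion. -/

section Torsion

theorem finite_torsionBy_prime {A : Type u} [AddCommGroup A] {p : ℕ} (hp : p.Prime)
    (h : pRank p A < Cardinal.aleph0) : {x : A | p • x = 0}.Finite := by
  have : Fact p.Prime := ⟨hp⟩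
  let _ : Module (ZMod p) (AddSubgroup.torsionBy A (p : ℤ)) := AddSubgroup.torsionBy.zmodModule
  have hfin : Module.Finite (ZMod p) (AddSubgroup.torsionBy A (p : ℤ)) :=
    Module.rank_lt_aleph0_iff.1 h
  have : Finite (AddSubgroup.torsionBy A (p : ℤ)) := Module.finite_of_finite (ZMod p)
  refine (Set.toFinite (AddSubgroup.torsionBy A (p : ℤ) : Set A)).subset fun x hx => ?_
  have hx' : p • x = 0 := hx
  have : (p : ℤ) • x = 0 := by rw [natCast_zsmul, hx']
  exact this

/-- Multiplication by `a` maps `A[ab]` into `A[b]`, with fibres cosets of `A[a]`. -/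
theorem finite_torsionBy_mul {A : Type u} [AddCommGroup A] {a b : ℕ}
    (ha : {x : A | a • x = 0}.Finite) (hb : {x : A | b • x = 0}.Finite) :
    {x : A | (a * b) • x = 0}.Finite := by
  refine Set.Finite.of_finite_fibers (fun x => a • x) (hb.subset ?_) fun y _ => ?_
  · rintro _ ⟨x, hx, rfl⟩
    have : (a * b) • x = 0 := hx
    rwa [mul_comm, mul_smul] at this
  · rcases Set.eq_empty_or_nonempty ({x : A | (a * b) • x = 0} ∩ (fun x => a • x) ⁻¹' {y})
      with h | ⟨x₀, hx₀⟩
    · rw [h]; exact Set.finite_empty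
    · refine (ha.image (fun t => x₀ + t)).subset fun x hx => ⟨x - x₀, ?_, by simp⟩
      have h1 : a • x = y := hx.2
      have h2 : a • x₀ = y := hx₀.2
      simp [smul_sub, h1, h2]

theorem finite_torsionBy {A : Type u} [AddCommGroup A]
    (h : ∀ p : ℕ, p.Prime → pRank p A < Cardinal.aleph0) {m : ℕ} (hm : m ≠ 0) :
    {x : A | m • x = 0}.Finite := by
  induction m using Nat.recOnMul with
  | zero => exact absurd rfl hm
  | one => exact (Set.finite_singleton 0).subset fun x hx => by simpa using hx
  | prime p hp => exact finite_torsionBy_prime hp (h p hp)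
  | mul a b iha ihb =>
    exact finite_torsionBy_mul (iha (left_ne_zero_of_mul hm)) (ihb (right_ne_zero_of_mul hm))

/-- The `φ`-stable subgroup generated by a finite set has bounded torsion, by noetherianity of
`ℤ[X]`. -/
theorem exists_stable_bounded_torsion {A : Type u} [AddCommGroup A] (φ : AddMonoid.End A)
    (Y : Finset A) : ∃ (M : AddSubgroup A) (m : ℕ), m ≠ 0 ∧ (Y : Set A) ⊆ M ∧
      (∀ x ∈ M, φ x ∈ M) ∧ ∀ x ∈ M, (∃ k : ℕ, k ≠ 0 ∧ k • x = 0) → m • x = 0 := by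
  classical
  let f : Module.End ℤ A := AddMonoidHom.toIntLinearMap φ
  let e := Module.AEval'.of f
  let M : Submodule (Polynomial ℤ) (Module.AEval' f) := Submodule.span _ (e '' Y)
  have hMfin : Module.Finite (Polynomial ℤ) M :=
    Module.Finite.span_of_finite _ ((Finset.finite_toSet Y).image e)
  -- The torsion of `M` is a `ℤ[X]`-submodule, hence finitely generated; the product of integers
  -- killing the generators kills all of it.
  let W : Submodule (Polynomial ℤ) M :=
    { carrier := {x | ∃ k : ℕ, k ≠ 0 ∧ k • x = 0}
      zero_mem' := ⟨1, one_ne_zero, smul_zero _⟩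
      add_mem' := by
        rintro x y ⟨k, hk, hx⟩ ⟨l, hl, hy⟩
        refine ⟨k * l, mul_ne_zero hk hl, ?_⟩
        rw [smul_add, mul_comm, mul_smul, hx, smul_zero, mul_comm, mul_smul, hy, smul_zero,
          add_zero]
      smul_mem' := by
        rintro c x ⟨k, hk, hx⟩
        exact ⟨k, hk, by rw [smul_comm, hx, smul_zero]⟩ }
  obtain ⟨s, hs⟩ := (IsNoetherian.noetherian W : W.FG)
  have hsW : ∀ x ∈ s, ∃ k : ℕ, k ≠ 0 ∧ k • x = 0 := fun x hx => by
    have : x ∈ W := hs ▸ Submodule.subset_span hx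
    exact this
  choose! k hk0 hk using hsW
  have hWm : ∀ x ∈ W, (∏ y ∈ s, k y) • x = 0 := by
    rw [← hs]
    intro x hx
    induction hx using Submodule.span_induction with
    | mem x hx =>
      rw [← Finset.prod_erase_mul s k hx, mul_smul, hk x hx, smul_zero]
    | zero => exact smul_zero _
    | add x y _ _ hx hy => rw [smul_add, hx, hy, add_zero]
    | smul a x _ hx => rw [smul_comm, hx, smul_zero]
  refine ⟨M.toAddSubgroup.comap (e : A →+ Module.AEval' f), ∏ y ∈ s, k y,
    Finset.prod_ne_zero_iff.2 hk0, ?_, ?_, ?_⟩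
  · intro y hy
    have hey : e y ∈ M := Submodule.subset_span ⟨y, hy, rfl⟩
    exact hey
  · intro x hx
    have hx' : e x ∈ M := hx
    have h := M.smul_mem (Polynomial.X : Polynomial ℤ) hx'
    rw [Module.AEval'.X_smul_of] at h
    exact h
  · rintro x hx ⟨l, hl, hlx⟩
    have hx' : e x ∈ M := hx
    have h := hWm ⟨e x, hx'⟩ ⟨l, hl, Subtype.ext (by
      change l • e x = 0
      rw [← map_nsmul, hlx, map_zero])⟩
    have h' : (∏ y ∈ s, k y) • e x = 0 := congrArg Subtype.val h
    rw [← map_nsmul] at h'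
    exact e.map_eq_zero_iff.1 h'

end Torsion

/-! ### Bounded growth over `ℚ`, by counting numerators. -/

section Box

/-- Vectors with coordinates of the form `c / m`, `c` an integer with `|c| ≤ k`. -/
def box (ι : Type*) (m k : ℕ) : Set (ι → ℚ) :=
  {v | ∀ i, ∃ c : ℤ, |c| ≤ k ∧ v i * m = c}

variable {ι : Type*}

theorem box_mul_subset (m k l : ℕ) : box ι m k ⊆ box ι (m * l) (k * l) := by
  intro v hv i
  obtain ⟨c, hc, h⟩ := hv i
  refine ⟨c * l, ?_, ?_⟩
  · rw [abs_mul, Nat.abs_cast]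
    push_cast
    gcongr
  · push_cast
    rw [← mul_assoc, h]

theorem box_mono {m k l : ℕ} (h : k ≤ l) : box ι m k ⊆ box ι m l := fun v hv i => by
  obtain ⟨c, hc, hv⟩ := hv i
  exact ⟨c, hc.trans (by exact_mod_cast h), hv⟩

theorem add_mem_box {m k l : ℕ} {v w : ι → ℚ} (hv : v ∈ box ι m k) (hw : w ∈ box ι m l) :
    v + w ∈ box ι m (k + l) := fun i => by
  obtain ⟨c, hc, hv⟩ := hv i
  obtain ⟨d, hd, hw⟩ := hw i
  refine ⟨c + d, (abs_add_le _ _).trans ?_, ?_⟩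
  · push_cast; gcongr
  · rw [Pi.add_apply, add_mul, hv, hw]; push_cast; rfl

theorem exists_common_denominator (s : Finset ℚ) :
    ∃ m k : ℕ, m ≠ 0 ∧ ∀ q ∈ s, ∃ c : ℤ, |c| ≤ k ∧ q * m = c := by
  classical
  induction s using Finset.induction_on with
  | empty => exact ⟨1, 0, one_ne_zero, by simp⟩
  | insert q s _ ih =>
    obtain ⟨m, k, hm, h⟩ := ih
    refine ⟨m * q.den, k * q.den + q.num.natAbs * m, mul_ne_zero hm q.den_ne_zero, ?_⟩
    intro r hr
    rcases Finset.mem_insert.1 hr with rfl | hr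
    · refine ⟨r.num * m, ?_, ?_⟩
      · rw [abs_mul, Nat.abs_cast, Int.abs_eq_natAbs]
        push_cast
        have : (0 : ℤ) ≤ k * r.den := by positivity
        linarith
      · push_cast
        rw [mul_comm (m : ℚ), ← mul_assoc, Rat.mul_den_eq_num]
    · obtain ⟨c, hc, h⟩ := h r hr
      refine ⟨c * q.den, ?_, ?_⟩
      · rw [abs_mul, Nat.abs_cast]
        push_cast
        have h1 : |c| * (q.den : ℤ) ≤ k * q.den := by gcongr
        have : (0 : ℤ) ≤ |q.num| * m := by positivity
        linarith
      · push_cast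
        rw [← mul_assoc, h]

variable [Fintype ι]

theorem exists_subset_box (Y : Finset (ι → ℚ)) : ∃ m k : ℕ, m ≠ 0 ∧ (Y : Set (ι → ℚ)) ⊆ box ι m k := by
  classical
  obtain ⟨m, k, hm, h⟩ :=
    exists_common_denominator (Y.biUnion fun y => Finset.univ.image y)
  exact ⟨m, k, hm, fun y hy i => h _ (Finset.mem_biUnion.2
    ⟨y, hy, Finset.mem_image_of_mem y (Finset.mem_univ i)⟩)⟩

/-- A vector is determined by its integer numerators, so the bound does not involve the denominator
`m`. -/
theorem card_le_of_subset_box {m k : ℕ} (hm : m ≠ 0) {T : Finset (ι → ℚ)}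
    (hT : (T : Set (ι → ℚ)) ⊆ box ι m k) : T.card ≤ (2 * k + 1) ^ Fintype.card ι := by
  classical
  have hcard : (Fintype.piFinset fun _ : ι => Finset.Icc (-(k : ℤ)) k).card =
      (2 * k + 1) ^ Fintype.card ι := by
    simp only [Fintype.card_piFinset, Int.card_Icc, Finset.prod_const, Finset.card_univ]
    congr 1
    omega
  rw [← hcard]
  have h : ∀ v ∈ T, ∃ c : ι → ℤ, ∀ i, |c i| ≤ k ∧ v i * m = c i := fun v hv => by
    choose c hc using hT hv
    exact ⟨c, hc⟩
  choose! c hc using h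
  refine Finset.card_le_card_of_injOn c (fun v hv => ?_) fun v hv w hw hvw => ?_
  · simp only [Finset.mem_coe, Fintype.mem_piFinset, Finset.mem_Icc]
    exact fun i => abs_le.1 (hc v hv i).1
  · funext i
    have h1 := (hc v hv i).2
    rw [hvw, ← (hc w hw i).2] at h1
    exact mul_right_cancel₀ (Nat.cast_ne_zero.2 hm) h1

theorem exists_map_box (f : (ι → ℚ) →ₗ[ℚ] (ι → ℚ)) :
    ∃ D R : ℕ, D ≠ 0 ∧ ∀ m k : ℕ, ∀ v ∈ box ι m k, f v ∈ box ι (m * D) (k * R) := by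
  classical
  obtain ⟨D, R, hD, h⟩ := exists_common_denominator
    (Finset.univ.image fun p : ι × ι => LinearMap.toMatrix' f p.1 p.2)
  choose c hc using fun i j => h (LinearMap.toMatrix' f i j)
    (Finset.mem_image.2 ⟨(i, j), Finset.mem_univ _, rfl⟩)
  refine ⟨D, Fintype.card ι * R, hD, fun m k v hv i => ?_⟩
  choose d hd using hv
  refine ⟨∑ j, c i j * d j, ?_, ?_⟩
  · calc |∑ j, c i j * d j| ≤ ∑ j, |c i j * d j| := Finset.abs_sum_le_sum_abs _ _
      _ ≤ ∑ _j : ι, (R : ℤ) * k := Finset.sum_le_sum fun j _ => by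
        rw [abs_mul]
        exact mul_le_mul (hc i j).1 (hd j).1 (abs_nonneg _) (Nat.cast_nonneg _)
      _ = _ := by
        rw [Finset.sum_const, Finset.card_univ, nsmul_eq_mul]
        push_cast
        ring
  · have hf : f v i = ∑ j, LinearMap.toMatrix' f i j * v j := by
      conv_lhs => rw [← LinearMap.toMatrix'_mulVec f v]
      rfl
    rw [hf, Finset.sum_mul]
    push_cast
    refine Finset.sum_congr rfl fun j _ => ?_
    rw [← (hc i j).2, ← (hd j).2]
    ring

theorem hasBoundedGrowth_of_linearMap {φ : AddMonoid.End (ι → ℚ)} (f : (ι → ℚ) →ₗ[ℚ] (ι → ℚ))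
    (hφ : ∀ v, φ v = f v) : HasBoundedGrowth φ := by
  classical
  obtain ⟨D, R, hD, hf⟩ := exists_map_box f
  -- `Q` dominates both the numerators and the denominator introduced by one application of `f`; the
  -- factor 2 absorbs the addition of `Y` at each step.
  let Q := R + D
  have hQ : 1 ≤ 2 * Q := by omega
  refine ⟨(2 * Q) ^ Fintype.card ι, fun Y => ?_⟩
  obtain ⟨m, k, hm, hY⟩ := exists_subset_box Y
  refine ⟨(2 * k + 1) ^ Fintype.card ι, fun n => ?_⟩
  have hbox : ∀ n, (orbitSum φ n Y : Set (ι → ℚ)) ⊆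
      box ι (m * D ^ n) (k * (2 * Q) ^ n) := by
    intro n
    induction n with
    | zero =>
      intro v hv i
      have hv0 : v = 0 := by simpa [orbitSum] using hv
      exact ⟨0, by simp, by simp [hv0]⟩
    | succ n ih =>
      rw [orbitSum_succ]
      intro v hv
      obtain ⟨y, hy, w, hw, rfl⟩ := Finset.mem_add.1 hv
      obtain ⟨t, ht, rfl⟩ := Finset.mem_image.1 hw
      -- Both summands must be written over the common denominator `m * D ^ (n + 1)`.
      have h1 := box_mul_subset m k (D ^ (n + 1)) (hY hy)
      have h2 := hf _ _ t (ih ht)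
      rw [hφ]
      rw [mul_assoc, ← pow_succ] at h2
      refine box_mono ?_ (add_mem_box h1 h2)
      have h3 : D ^ (n + 1) ≤ (2 * Q) ^ n * Q := by
        rw [pow_succ]
        exact Nat.mul_le_mul (Nat.pow_le_pow_left (by omega) n) (by omega)
      have h4 : (2 * Q) ^ n * R ≤ (2 * Q) ^ n * Q := Nat.mul_le_mul_left _ (by omega)
      calc k * D ^ (n + 1) + k * (2 * Q) ^ n * R
          = k * (D ^ (n + 1) + (2 * Q) ^ n * R) := by ring
        _ ≤ k * ((2 * Q) ^ n * Q + (2 * Q) ^ n * Q) := by gcongr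
        _ = k * (2 * Q) ^ (n + 1) := by ring
  refine (card_le_of_subset_box (by positivity) (hbox n)).trans ?_
  rw [← pow_mul, mul_comm _ n, pow_mul, ← mul_pow]
  refine Nat.pow_le_pow_left ?_ _
  have : 1 ≤ (2 * Q) ^ n := Nat.one_le_pow _ _ hQ
  nlinarith

end Box

/-! ### Bounded growth for groups of finite ranks. -/

section FiniteRanks

theorem image_orbitSum {A B : Type*} [AddCommGroup A] [AddCommGroup B] [DecidableEq B]
    (φ : AddMonoid.End A) (ψ : AddMonoid.End B) (f : A →+ B) (h : ∀ a, f (φ a) = ψ (f a))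
    (n : ℕ) (Y : Finset A) :
    (orbitSum φ n Y).image f = orbitSum ψ n (Y.image f) := by
  classical
  induction n with
  | zero => simp [orbitSum, ← Finset.singleton_zero]
  | succ n ih =>
    rw [orbitSum_succ, Finset.image_add, orbitSum_succ, ← ih, Finset.image_image,
      Finset.image_image]
    congr 1
    exact Finset.image_congr fun a _ => h a

theorem orbitSum_subset {A : Type*} [AddCommGroup A] {φ : AddMonoid.End A} {Y : Finset A}
    {M : AddSubgroup A} (hY : (Y : Set A) ⊆ M) (hM : ∀ x ∈ M, φ x ∈ M) (n : ℕ) :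
    (orbitSum φ n Y : Set A) ⊆ M := by
  classical
  induction n with
  | zero => simp [orbitSum]
  | succ n ih =>
    rw [orbitSum_succ]
    intro x hx
    obtain ⟨y, hy, w, hw, rfl⟩ := Finset.mem_add.1 hx
    obtain ⟨t, ht, rfl⟩ := Finset.mem_image.1 hw
    exact M.add_mem (hY hy) (hM t (ih ht))

/-- Bounded growth lifts along a map to a group with bounded growth whose kernel is torsion. -/
theorem HasBoundedGrowth.of_torsion_kernel {A B : Type*} [AddCommGroup A] [AddCommGroup B]
    (hA : ∀ p : ℕ, p.Prime → pRank p A < Cardinal.aleph0)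
    {φ : AddMonoid.End A} {ψ : AddMonoid.End B} (hψ : HasBoundedGrowth ψ) (f : A →+ B)
    (h : ∀ a, f (φ a) = ψ (f a)) (hker : ∀ a, f a = 0 → ∃ k : ℕ, k ≠ 0 ∧ k • a = 0) :
    HasBoundedGrowth φ := by
  classical
  obtain ⟨B, hB⟩ := hψ
  refine ⟨B, fun Y => ?_⟩
  obtain ⟨C, hC⟩ := hB (Y.image f)
  obtain ⟨M, m, hm, hYM, hM, htor⟩ := exists_stable_bounded_torsion φ Y
  let W := (finite_torsionBy hA hm).toFinset
  refine ⟨W.card * C, fun n => ?_⟩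
  have hsub := orbitSum_subset hYM hM n
  -- Differences within a fibre of `f` are torsion elements of `M`, hence lie in `A[m]`, and `m`
  -- does not depend on `n`.
  have h1 := Finset.card_le_mul_card_image (f := f) (orbitSum φ n Y) W.card fun b hb => by
    obtain ⟨x₀, hx₀, rfl⟩ := Finset.mem_image.1 hb
    refine Finset.card_le_card_of_injOn (fun x => x - x₀) (fun x hx => ?_)
      fun x _ y _ hxy => sub_left_injective hxy
    obtain ⟨hx, hfx⟩ := Finset.mem_filter.1 hx
    refine (Set.Finite.mem_toFinset _).2 (htor _ (M.sub_mem (hsub hx) (hsub hx₀)) (hker _ ?_))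
    rw [map_sub, hfx, sub_self]
  rw [image_orbitSum φ ψ f h] at h1
  refine h1.trans ?_
  rw [mul_assoc]
  exact Nat.mul_le_mul_left _ (hC n)

/-- The map `a ↦ 1 ⊗ a` intertwines `φ` with its base change on a finite-dimensional rational space,
and its kernel is torsion because it is a localization at the nonzero integers. -/
theorem HasFiniteRanks.hasBoundedGrowth {A : Type u} [AddCommGroup A] (hA : HasFiniteRanks A)
    (φ : AddMonoid.End A) : HasBoundedGrowth φ := by
  have hfin : Module.Finite ℚ (ℚ ⊗[ℤ] A) := Module.rank_lt_aleph0_iff.1 hA.1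
  let e := (Module.finBasis ℚ (ℚ ⊗[ℤ] A)).equivFun
  let F : (ℚ ⊗[ℤ] A) →ₗ[ℚ] (ℚ ⊗[ℤ] A) := LinearMap.baseChange ℚ (AddMonoidHom.toIntLinearMap φ)
  let ι := TensorProduct.mk ℤ ℚ A 1
  refine HasBoundedGrowth.of_torsion_kernel hA.2
    (hasBoundedGrowth_of_linearMap
      (φ := (e.toLinearMap ∘ₗ F ∘ₗ e.symm.toLinearMap).toAddMonoidHom)
      (e.toLinearMap ∘ₗ F ∘ₗ e.symm.toLinearMap) fun _ => rfl)
    ((e : ℚ ⊗[ℤ] A →+ _).comp (ι : A →+ ℚ ⊗[ℤ] A)) (fun a => ?_) fun a ha => ?_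
  · change e (ι (φ a)) = e (F (e.symm (e (ι a))))
    rw [e.symm_apply_apply]
    rfl
  · have h0 : ι a = 0 := e.map_eq_zero_iff.1 ha
    obtain ⟨s, hs⟩ := (IsLocalizedModule.eq_zero_iff (nonZeroDivisors ℤ) ι).1 h0
    refine ⟨(s : ℤ).natAbs, Int.natAbs_ne_zero.2 (nonZeroDivisors.coe_ne_zero s), ?_⟩
    have hs' : (s : ℤ) • a = 0 := hs
    rcases Int.natAbs_eq (s : ℤ) with h | h
    · rw [h, natCast_zsmul] at hs'
      exact hs'
    · rw [h, neg_smul, natCast_zsmul, neg_eq_zero] at hs'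
      exact hs'

theorem HasFiniteRanks.of_torsionFree {A : Type u} [AddCommGroup A] (hA : IsAddTorsionFree A)
    (h : freeRank A < Cardinal.aleph0) : HasFiniteRanks A := by
  refine ⟨h, fun p hp => ?_⟩
  have : Fact p.Prime := ⟨hp⟩
  let _ : Module (ZMod p) (AddSubgroup.torsionBy A (p : ℤ)) := AddSubgroup.torsionBy.zmodModule
  have hsub : Subsingleton (AddSubgroup.torsionBy A (p : ℤ)) := by
    refine ⟨fun x y => Subtype.ext ?_⟩
    have hz : ∀ z : AddSubgroup.torsionBy A (p : ℤ), (z : A) = 0 := fun z => by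
      have hz : (p : ℤ) • (z : A) = 0 := z.2
      rw [natCast_zsmul] at hz
      exact (nsmul_eq_zero_iff_right hp.ne_zero).1 hz
    rw [hz, hz]
  have : pRank p A = 0 := rank_subsingleton' _ _
  rw [this]
  exact Cardinal.aleph0_pos

end FiniteRanks

/-! ### Thick directions in groups, `ℕ ^ d` and `ℤ ^ d`. -/

section Thick

theorem isThickAlong_of_infinite_quotient {G : Type u} [CommGroup G] {g : G}
    (hg : Function.Injective fun i : ℕ => g ^ i) (hinf : Infinite (G ⧸ Subgroup.zpowers g)) :
    IsThickAlong g := by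
  classical
  intro K
  obtain ⟨s, hs⟩ := Infinite.exists_subset_card_eq (G ⧸ Subgroup.zpowers g) K
  -- `P` represents `K` distinct cosets of `⟨g⟩`. If `z * P` meets a row of `x * P`, the transversal
  -- discrepancy is a quotient `q * p⁻¹`.
  refine ⟨s.image Quotient.out, s.image Quotient.out * (s.image Quotient.out)⁻¹, ?_, ?_, ?_⟩
  · rw [Finset.card_image_of_injective s Quotient.out_injective, hs]
  · intro i j p hp q hq h
    obtain ⟨p, _, rfl⟩ := Finset.mem_image.1 hp
    obtain ⟨q, _, rfl⟩ := Finset.mem_image.1 hq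
    have hpow : ∀ i : ℕ, ((g ^ i : G) : G ⧸ Subgroup.zpowers g) = 1 := fun i =>
      (QuotientGroup.eq_one_iff _).2 (pow_mem (Subgroup.mem_zpowers g) i)
    have h' := congrArg (QuotientGroup.mk : G → G ⧸ Subgroup.zpowers g) h
    rw [QuotientGroup.mk_mul, QuotientGroup.mk_mul, hpow, hpow, one_mul, one_mul,
      QuotientGroup.out_eq', QuotientGroup.out_eq'] at h'
    subst h'
    exact ⟨hg (mul_right_cancel h), rfl⟩
  · intro n x
    -- The shift by `n` turns the exponent `j - i` into `n + j - i`, a natural number below `2 * n`.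
    refine ⟨x * (g ^ n)⁻¹, ?_⟩
    rintro z ⟨i, hi, p, hp, j, hj, q, hq, h⟩
    refine ⟨n + j - i, by omega, q * p⁻¹,
      Finset.mul_mem_mul hq (Finset.inv_mem_inv hp), ?_⟩
    have hk : g ^ (n + j - i) * g ^ i = g ^ n * g ^ j := by
      rw [← pow_add, ← pow_add]
      congr 1
      omega
    have hz : x * (g ^ n)⁻¹ * (g ^ (n + j - i) * (q * p⁻¹)) * (g ^ i * p) = z * (g ^ i * p) :=
      calc _ = x * (g ^ n)⁻¹ * (g ^ (n + j - i) * g ^ i) * q * (p⁻¹ * p) := by ac_rfl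
        _ = x * (g ^ j * q) * ((g ^ n)⁻¹ * g ^ n) := by
          rw [hk, inv_mul_cancel, mul_one]
          ac_rfl
        _ = z * (g ^ i * p) := by rw [inv_mul_cancel, mul_one, h]
    exact (mul_right_cancel hz).symm

theorem isThickAlong_single_nat {κ : Type u} [DecidableEq κ] {a b : κ} (hab : a ≠ b) :
    IsThickAlong (Multiplicative.ofAdd (Pi.single a 1 : κ → ℕ)) := by
  classical
  intro K
  let e : ℕ → Multiplicative (κ → ℕ) := fun k => Multiplicative.ofAdd (Pi.single b k)
  have hcoord : ∀ (i p : ℕ) (c : κ),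
      Multiplicative.toAdd (Multiplicative.ofAdd (Pi.single a 1 : κ → ℕ) ^ i * e p) c =
        if c = a then i else if c = b then p else 0 := by
    intro i p c
    simp only [e, toAdd_mul, toAdd_pow, toAdd_ofAdd, Pi.add_apply, Pi.smul_apply,
      Pi.single_apply, smul_eq_mul]
    split_ifs <;> simp_all
  have he : Function.Injective e := fun p q h => by
    simpa [e] using congrFun (congrArg Multiplicative.toAdd h) b
  refine ⟨(Finset.range K).image e, (Finset.range (2 * K)).image e, ?_, ?_, ?_⟩
  · rw [Finset.card_image_of_injective _ he, Finset.card_range]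
  · intro i j p hp q hq h
    obtain ⟨p, _, rfl⟩ := Finset.mem_image.1 hp
    obtain ⟨q, _, rfl⟩ := Finset.mem_image.1 hq
    have h' := fun c => congrFun (congrArg Multiplicative.toAdd h) c
    simp only [hcoord] at h'
    have ha := h' a
    have hb := h' b
    simp only [if_true, hab.symm, if_false] at ha hb
    exact ⟨ha, by rw [hb]⟩
  · intro n x
    -- Without inverses, `x` is moved back by `n` along `a` and by `K` along `b` with truncation at
    -- 0. This is harmless since the coordinates of `z` are nonnegative too.
    refine ⟨Multiplicative.ofAdd fun c => if c = a then Multiplicative.toAdd x a - n else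
      if c = b then Multiplicative.toAdd x b - K else Multiplicative.toAdd x c, ?_⟩
    rintro z ⟨i, hi, p, hp, j, hj, q, hq, h⟩
    obtain ⟨p, hpK, rfl⟩ := Finset.mem_image.1 hp
    obtain ⟨q, hqK, rfl⟩ := Finset.mem_image.1 hq
    rw [Finset.mem_range] at hpK hqK
    have h' := fun c => congrFun (congrArg Multiplicative.toAdd h) c
    simp only [toAdd_mul _ (_ * _), Pi.add_apply, hcoord] at h'
    have ha := h' a
    have hb := h' b
    simp only [if_true, hab.symm, if_false] at ha hb
    refine ⟨Multiplicative.toAdd z a - (Multiplicative.toAdd x a - n), by omega,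
      e (Multiplicative.toAdd z b - (Multiplicative.toAdd x b - K)),
      Finset.mem_image_of_mem e (Finset.mem_range.2 (by omega)), ?_⟩
    refine Multiplicative.toAdd.injective (funext fun c => ?_)
    rw [toAdd_mul, Pi.add_apply, hcoord, toAdd_ofAdd]
    have hc := h' c
    split_ifs at hc ⊢ with h1 h2
    · subst h1; omega
    · subst h2; omega
    · exact hc

theorem isThickAlong_single_int {κ : Type u} [DecidableEq κ] {a b : κ} (hab : a ≠ b) :
    IsThickAlong (Multiplicative.ofAdd (Pi.single a 1 : κ → ℤ)) := by
  refine isThickAlong_of_infinite_quotient (fun i j h => ?_) ?_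
  · simpa using congrFun (congrArg Multiplicative.toAdd h) a
  · refine Infinite.of_injective (fun k : ℕ => ((Multiplicative.ofAdd (Pi.single b (k : ℤ)) :
      Multiplicative (κ → ℤ)) : _ ⧸ Subgroup.zpowers
        (Multiplicative.ofAdd (Pi.single a 1 : κ → ℤ)))) fun k l h => ?_
    obtain ⟨n, hn⟩ := Subgroup.mem_zpowers_iff.1 (QuotientGroup.eq.1 h)
    have hb := congrFun (congrArg Multiplicative.toAdd hn) b
    simp [hab.symm] at hb
    omega

theorem exists_isThickAlong {G : Type u} [CommGroup G] (hG : ∃ g : G, ¬ IsOfFinOrder g)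
    (hcyc : ¬ IsVirtuallyCyclic G) : ∃ g : G, IsThickAlong g := by
  obtain ⟨g, hg⟩ := hG
  refine ⟨g, isThickAlong_of_infinite_quotient (injective_pow_iff_not_isOfFinOrder.2 hg) ?_⟩
  rw [← not_finite_iff_infinite]
  exact fun _ => hcyc ⟨Subgroup.zpowers g, inferInstance,
    Subgroup.finiteIndex_of_finite_quotient⟩

end Thick

end AlgebraicEntropy

theorem mainTheorem10 (A : Type u) [AddCommGroup A] :
    (∀ d : ℕ, 1 < d → IsAddTorsionFree A → AlgebraicEntropy.freeRank A < Cardinal.aleph0 →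
      ∀ α : Multiplicative (Fin d → ℕ) →* AddMonoid.End A,
        AlgebraicEntropy.EntropyWellDefined α ∧ AlgebraicEntropy.hAlg α = 0) ∧
    (∀ d : ℕ, 1 < d → IsAddTorsionFree A → AlgebraicEntropy.freeRank A < Cardinal.aleph0 →
      ∀ α : Multiplicative (Fin d → ℤ) →* AddMonoid.End A,
        AlgebraicEntropy.EntropyWellDefined α ∧ AlgebraicEntropy.hAlg α = 0) ∧
    (AlgebraicEntropy.HasFiniteRanks A →
      ∀ (G : Type v) [CommGroup G], (∃ g : G, ¬ IsOfFinOrder g) →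
        ¬ AlgebraicEntropy.IsVirtuallyCyclic G →
        ∀ α : G →* AddMonoid.End A,
          AlgebraicEntropy.EntropyWellDefined α ∧ AlgebraicEntropy.hAlg α = 0) := by
  open AlgebraicEntropy in
  refine ⟨fun d hd hA hr α => ?_, fun d hd hA hr α => ?_, fun hA G _ hG hcyc α => ?_⟩
  · have hab : (⟨0, by omega⟩ : Fin d) ≠ ⟨1, hd⟩ := by simp
    exact entropy_eq_zero α (isThickAlong_single_nat hab)
      ((HasFiniteRanks.of_torsionFree hA hr).hasBoundedGrowth _)
  · have hab : (⟨0, by omega⟩ : Fin d) ≠ ⟨1, hd⟩ := by simp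
    exact entropy_eq_zero α (isThickAlong_single_int hab)
      ((HasFiniteRanks.of_torsionFree hA hr).hasBoundedGrowth _)
  · obtain ⟨g, hg⟩ := exists_isThickAlong hG hcyc
    exact entropy_eq_zero α hg (hA.hasBoundedGrowth _)
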